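/- Let $\mathbb K$ be a field of characteristic zero, let $\mathcal L$ be a Lie algebra over $\mathbb K$ with a finite basis $X_1,\dots,X_n$ ($n\ge 0$), and let $\mathcal U(\mathcal L)$ be its universal enveloping algebra; we write $X_i$ also for the image of $X_i$ in $\mathcal U(\mathcal L)$. For a multi-index $\alpha=(\alpha_1,\dots,\alpha_n)$ of non-negative integers put $m=|\alpha|=\alpha_1+\cdots+\alpha_n$ and $X^{(\alpha)}=X_1^{\alpha_1}\cdots X_n^{\alpha_n}$. Let $(X'_1,\dots,X'_m)$ be the sequence consisting of $\alpha_1$ copies of $X_1$, followed by $\alpha_2$ copies of $X_2$, and so on up to $\alpha_n$ copies of $X_n$, and put $$\operatorname{Sym}(X^{(\alpha)})=\frac1{m!}\sum_{\sigma\in\Sigma_m}X'_{\sigma(1)}\cdots X'_{\sigma(m)},$$ where $\Sigma_m$ is the group of permutations of $\{1,\dots,m\}$. Call two non-commutative (formal) monomials $X_{i_1}\cdots X_{i_m}$ ($m\ge 0$, $1\le i_j\le n$) equipollent if they differ only by the order of their factors. Then: (1) the family $\operatorname{Sym}(X^{(\alpha)})$, $\alpha\in\mathbb Z_{\ge0}^n$,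 is a vector-space basis of $\mathcal U(\mathcal L)$; (2) if $S$ is any set of formal monomials $X_{i_1}\cdots X_{i_m}$ containing exactly one representative of each equipollence class, then the images in $\mathcal U(\mathcal L)$ of the elements of $S$ form a basis of $\mathcal U(\mathcal L)$ indexed by $S$; (3) in particular, the family of ordered monomials $X_1^{\alpha_1}\cdots X_n^{\alpha_n}$, $\alpha\in\mathbb Z_{\ge0}^n$, is a basis of $\mathcal U(\mathcal L)$; (4) the linear map $\mathbb K[x_1,\dots,x_n]\to\mathcal U(\mathcal L)$ from the commutative polynomial algebra that sends $x_1^{\alpha_1}\cdots x_n^{\alpha_n}$ to $\operatorname{Sym}(X^{(\alpha)})$ for every $\alpha$ is an isomorphism of vector spaces. -/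

import Mathlib

open scoped Nat

noncomputable section

namespace PBW

variable {n : ℕ}

/-- A word `(i₁, …, iₘ)` in the letters `0, …, n - 1`; it encodes the noncommutative monomial
`X_{i₁} ⋯ X_{iₘ}`. -/
abbrev Word (n : ℕ) : Type := List (Fin n)

/-- Two monomials are equipollent if they differ only by the order of their factors. -/
def Equipollent (v w : Word n) : Prop := List.Perm v w

/-- `S` contains exactly one representative of every equipollence class of monomials. -/
def IsRepresentativeSystem (S : Set (Word n)) : Prop :=
  ∀ v : Word n, ∃! w : Word n, w ∈ S ∧ Equipollent w v

/-- The word `(X'₁, …, X'ₘ)`, `m = |α|`, consisting of `α 0` letters `0`, followed by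
`α 1` letters `1`, and so on. -/
def sortedWord (α : Fin n →₀ ℕ) : Word n :=
  (List.finRange n).flatMap fun i => List.replicate (α i) i

variable (K : Type*) [Field K]

/-- The monomial `X_{i₁} ⋯ X_{iₘ}` in the algebra of noncommutative polynomials in `n` variables. -/
def monomial (w : Word n) : FreeAlgebra K (Fin n) := (w.map (FreeAlgebra.ι K)).prod

/-- The symmetrization `(1 / m!) ∑_σ X'_{σ 1} ⋯ X'_{σ m}` of the monomial `X'₁ ⋯ X'ₘ`, the sum
being over all permutations `σ` of the `m` positions. -/
def sym (w : Word n) : FreeAlgebra K (Fin n) :=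
  ((w.length ! : ℕ) : K)⁻¹ •
    ∑ σ : Equiv.Perm (Fin w.length), monomial K (List.ofFn fun j => w.get (σ j))

/-- The symmetrization map from commutative to noncommutative polynomials: the linear map that
sends `x₁^{α₁} ⋯ xₙ^{αₙ}` to `Sym (X₁^{α₁} ⋯ Xₙ^{αₙ})`. -/
def symmetrization (n : ℕ) : MvPolynomial (Fin n) K →ₗ[K] FreeAlgebra K (Fin n) :=
  (MvPolynomial.basisMonomials (Fin n) K).constr K fun α => sym K (sortedWord α)

variable {K} {L : Type*} [LieRing L] [LieAlgebra K L]

/-- The canonical algebra homomorphism from noncommutative polynomials to the universal enveloping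
algebra, sending the `i`-th variable to the image of the `i`-th basis element of `L`. -/
def toEnveloping (X : Module.Basis (Fin n) K L) :
    FreeAlgebra K (Fin n) →ₐ[K] UniversalEnvelopingAlgebra K L :=
  FreeAlgebra.lift K fun i => UniversalEnvelopingAlgebra.ι K (X i)

end PBW

end

/-! Everything rests on a representation of `L` on the polynomials in which `X_i` multiplies by
`x_i` up to terms of lower degree. If `i` is at most every letter of `M`, then `X_i` sends `x^M` to
`x_i x^M`. Otherwise `M = x_j N` with least letter `j < i`, and `X_i (x_j N) = X_j (X_i N) + [X_i,
X_j] N` is forced. This recursion on the degree defines `action`; the Jacobi identity makes it a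
representation (`compatible`), so it extends to the enveloping algebra.

Acting on the polynomial `1` gives `symbolMap`, which sends a word to its commutative monomial plus
lower terms. It is injective because `orderedMap`, the map to ordered monomials, intertwines the
actions and so inverts it on the left. A family with prescribed leading monomials becomes
unitriangular after `symbolMap`, hence is a basis (`exists_basis_of_symbol`). Ordered monomials,
representatives and symmetrizations all have such leading terms. -/

namespace PBW

/-! ### Degree filtration and unitriangular maps -/

section Triangular

variable {n : ℕ} {K : Type*} [Field K]

/-- The polynomials of degree less than `d`, as finitely supported functions on exponents. -/
def lowDegree (n : ℕ) (K : Type*) [Field K] (d : ℕ) : Submodule K ((Fin n →₀ ℕ) →₀ K) :=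
  Finsupp.supported K K {M | M.degree < d}

/-- The monomial with exponent `M`. -/
noncomputable abbrev mono (K : Type*) [Field K] (M : Fin n →₀ ℕ) : (Fin n →₀ ℕ) →₀ K := Finsupp.single M 1

/-- Adjoining the letter `i` to an exponent. -/
noncomputable abbrev adjoin (i : Fin n) (M : Fin n →₀ ℕ) : Fin n →₀ ℕ := Finsupp.single i 1 + M

theorem degree_adjoin (i : Fin n) (M : Fin n →₀ ℕ) : (adjoin i M).degree = M.degree + 1 := by
  simp [adjoin, add_comm]

theorem adjoin_left_comm (i j : Fin n) (M : Fin n →₀ ℕ) :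
    adjoin i (adjoin j M) = adjoin j (adjoin i M) := add_left_comm _ _ _

theorem lowDegree_mono {d e : ℕ} (h : d ≤ e) : lowDegree n K d ≤ lowDegree n K e :=
  Finsupp.supported_mono fun _ hM => lt_of_lt_of_le hM h

theorem mono_mem_lowDegree {M : Fin n →₀ ℕ} {d : ℕ} (h : M.degree < d) :
    mono K M ∈ lowDegree n K d :=
  Finsupp.single_mem_supported K _ h

/-- A property of polynomials that is stable under linear combinations can be checked on
monomials. -/
theorem lowDegree_le {d : ℕ} {P : Submodule K ((Fin n →₀ ℕ) →₀ K)}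
    (h : ∀ M : Fin n →₀ ℕ, M.degree < d → mono K M ∈ P) : lowDegree n K d ≤ P := by
  rw [lowDegree, Finsupp.supported_eq_span_single, Submodule.span_le]
  rintro _ ⟨M, hM, rfl⟩
  exact h M hM

theorem lowDegree_zero : lowDegree n K 0 = ⊥ :=
  le_bot_iff.1 (lowDegree_le fun _ h => absurd h (Nat.not_lt_zero _))

theorem exists_mem_lowDegree (f : (Fin n →₀ ℕ) →₀ K) : ∃ d, f ∈ lowDegree n K d := by
  refine ⟨f.support.sup Finsupp.degree + 1, fun M hM => ?_⟩
  exact Nat.lt_succ_of_le (Finset.le_sup (f := Finsupp.degree) hM)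

/-- A unitriangular endomorphism with respect to the degree is bijective. -/
theorem bijective_of_unitriangular (g : ((Fin n →₀ ℕ) →₀ K) →ₗ[K] ((Fin n →₀ ℕ) →₀ K))
    (hg : ∀ M, g (mono K M) - mono K M ∈ lowDegree n K M.degree) : Function.Bijective g := by
  -- Since `g - id` lowers the degree, a kernel element descends to degree below zero, and preimages
  -- are corrected degree by degree.
  have low : ∀ d, ∀ f ∈ lowDegree n K (d + 1), g f - f ∈ lowDegree n K d := by
    intro d
    exact lowDegree_le (P := (lowDegree n K d).comap (g - LinearMap.id)) fun M hM =>
      lowDegree_mono (Nat.lt_succ_iff.1 hM) (hg M)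
  constructor
  · rw [injective_iff_map_eq_zero]
    intro f hf
    obtain ⟨d, hd⟩ := exists_mem_lowDegree f
    induction d with
    | zero => simpa [lowDegree_zero] using hd
    | succ d ih =>
      have := low d f hd
      rw [hf, zero_sub, Submodule.neg_mem_iff] at this
      exact ih this
  · intro f
    obtain ⟨d, hd⟩ := exists_mem_lowDegree f
    have : ∀ d, lowDegree n K d ≤ LinearMap.range g := by
      intro d
      induction d with
      | zero => simp [lowDegree_zero]
      | succ d ih =>
        intro f hf
        have := (LinearMap.range g).sub_mem (LinearMap.mem_range_self g f) (ih (low d f hf))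
        simpa using this
    exact this d hd

end Triangular

/-! ### The representation of the Lie algebra on polynomials -/

section Action

variable {n : ℕ} {K : Type*} [Field K] {L : Type*} [LieRing L] [LieAlgebra K L]

open Classical in
/-- Successive approximations to the action of a Lie algebra on polynomials: the `d`-th one is
correct in degrees at most `d`. -/
noncomputable def approxAction (X : Module.Basis (Fin n) K L) :
    ℕ → L →ₗ[K] Module.End K ((Fin n →₀ ℕ) →₀ K)
  | 0 => X.constr K fun i => Finsupp.linearCombination K fun M => mono K (adjoin i M)
  | d + 1 => X.constr K fun i => Finsupp.linearCombination K fun M =>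
      -- In `X_j (X_i N)` the leading part `x_i N` is split off, since `X_j` just multiplies it by
      -- `x_j`. What remains has degree at most that of `N`, so stage `d` suffices.
      if h : ∃ j N, M = adjoin j N ∧ (∀ k ∈ N.support, j ≤ k) ∧ j < i then
        mono K (adjoin i M) +
          (approxAction X d (X h.choose)
            (approxAction X d (X i) (mono K h.choose_spec.choose) -
              mono K (adjoin i h.choose_spec.choose)) +
          approxAction X d ⁅X i, X h.choose⁆ (mono K h.choose_spec.choose))
      else mono K (adjoin i M)

theorem approxAction_zero (X : Module.Basis (Fin n) K L) (i : Fin n) (M : Fin n →₀ ℕ) :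
    approxAction X 0 (X i) (mono K M) = mono K (adjoin i M) := by
  simp [approxAction]

/-- The least letter of an exponent, and what remains, are determined by the exponent. -/
theorem adjoin_inj_of_le {i j : Fin n} {M N : Fin n →₀ ℕ} (hM : ∀ k ∈ M.support, i ≤ k)
    (hN : ∀ k ∈ N.support, j ≤ k) (h : adjoin i M = adjoin j N) : i = j ∧ M = N := by
  have key : ∀ {i j : Fin n} {M N : Fin n →₀ ℕ}, (∀ k ∈ N.support, j ≤ k) →
      adjoin i M = adjoin j N → j ≤ i := by
    intro i j M N hN h
    by_contra hij
    have h1 := DFunLike.congr_fun h i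
    have h2 : N i = 0 := by
      by_contra h0
      exact hij (hN i (Finsupp.mem_support_iff.2 h0))
    have h3 : j ≠ i := fun e => hij e.le
    simp [adjoin, h2, h3] at h1
  obtain rfl : i = j := le_antisymm (key hM h.symm) (key hN h)
  exact ⟨rfl, add_left_cancel h⟩

theorem exists_eq_adjoin {M : Fin n →₀ ℕ} (hM : M.support.Nonempty) :
    ∃ j N, M = adjoin j N ∧ (∀ k ∈ N.support, j ≤ k) := by
  obtain ⟨j, hj, hmin⟩ := M.support.exists_minimal hM
  have hle : Finsupp.single j 1 ≤ M := by
    rw [Finsupp.single_le_iff]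
    exact Nat.one_le_iff_ne_zero.2 (Finsupp.mem_support_iff.1 hj)
  refine ⟨j, M - Finsupp.single j 1, (add_tsub_cancel_of_le hle).symm, fun k hk => ?_⟩
  have hk' : k ∈ M.support := Finsupp.support_mono tsub_le_self hk
  rcases le_total j k with h | h
  · exact h
  · exact hmin hk' h

theorem approxAction_succ_of_le (X : Module.Basis (Fin n) K L) (d : ℕ) {i : Fin n}
    {M : Fin n →₀ ℕ} (h : ∀ k ∈ M.support, i ≤ k) :
    approxAction X (d + 1) (X i) (mono K M) = mono K (adjoin i M) := by
  have : ¬ ∃ j N, M = adjoin j N ∧ (∀ k ∈ N.support, j ≤ k) ∧ j < i := by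
    rintro ⟨j, N, rfl, -, hj⟩
    exact hj.not_ge (h j (by simp [adjoin]))
  simp only [approxAction, Module.Basis.constr_basis, Finsupp.linearCombination_single, one_smul]
  rw [dif_neg this]

theorem approxAction_succ_of_lt (X : Module.Basis (Fin n) K L) (d : ℕ) {i j : Fin n}
    {N : Fin n →₀ ℕ} (hN : ∀ k ∈ N.support, j ≤ k) (hj : j < i) :
    approxAction X (d + 1) (X i) (mono K (adjoin j N)) = mono K (adjoin i (adjoin j N)) +
      (approxAction X d (X j) (approxAction X d (X i) (mono K N) - mono K (adjoin i N)) +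
        approxAction X d ⁅X i, X j⁆ (mono K N)) := by
  have h : ∃ j' N', adjoin j N = adjoin j' N' ∧ (∀ k ∈ N'.support, j' ≤ k) ∧ j' < i :=
    ⟨j, N, rfl, hN, hj⟩
  obtain ⟨h1, h2⟩ := adjoin_inj_of_le hN h.choose_spec.choose_spec.2.1
    h.choose_spec.choose_spec.1
  simp only [approxAction, Module.Basis.constr_basis, Finsupp.linearCombination_single, one_smul]
  rw [dif_pos h, ← h2, ← h1]

/-- Either `i` is at most all letters of `M`, or `M` has a least letter smaller than `i`. -/
theorem le_or_exists_eq_adjoin (i : Fin n) (M : Fin n →₀ ℕ) :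
    (∀ k ∈ M.support, i ≤ k) ∨ ∃ j N, M = adjoin j N ∧ (∀ k ∈ N.support, j ≤ k) ∧ j < i := by
  rcases M.support.eq_empty_or_nonempty with h | h
  · simp [h]
  obtain ⟨j, N, rfl, hN⟩ := exists_eq_adjoin h
  rcases lt_or_ge j i with hj | hj
  · exact Or.inr ⟨j, N, rfl, hN, hj⟩
  · refine Or.inl fun k hk => ?_
    rcases Finset.mem_union.1 (Finsupp.support_add hk) with h | h
    · rw [Finset.mem_singleton.1 (Finsupp.support_single_subset h)]
      exact hj
    · exact hj.trans (hN k h)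

@[elab_as_elim]
theorem basis_induction (X : Module.Basis (Fin n) K L) {P : L → Prop} (zero : P 0)
    (add : ∀ x y, P x → P y → P (x + y)) (smul : ∀ (c : K) x, P x → P (c • x))
    (basis : ∀ i, P (X i)) (x : L) : P x :=
  Submodule.span_induction (p := fun x _ => P x) (by rintro _ ⟨i, rfl⟩; exact basis i) zero
    (fun x y _ _ => add x y) (fun c x _ => smul c x) (X.mem_span x)

/-- An operation that raises the degree on monomials by at most one does so everywhere. -/
theorem apply_mem_lowDegree {X : Module.Basis (Fin n) K L}
    {A : L →ₗ[K] Module.End K ((Fin n →₀ ℕ) →₀ K)} {d : ℕ}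
    (hA : ∀ i M, M.degree < d →
      A (X i) (mono K M) - mono K (adjoin i M) ∈ lowDegree n K (M.degree + 1))
    (x : L) {f : (Fin n →₀ ℕ) →₀ K} (hf : f ∈ lowDegree n K d) :
    A x f ∈ lowDegree n K (d + 1) := by
  have hbasis : ∀ i, A (X i) f ∈ lowDegree n K (d + 1) := fun i => by
    refine lowDegree_le (P := (lowDegree n K (d + 1)).comap (A (X i))) (fun M hM => ?_) hf
    have h1 : A (X i) (mono K M) - mono K (adjoin i M) ∈ lowDegree n K (d + 1) :=
      lowDegree_mono (by omega) (hA i M hM)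
    have h2 : mono K (adjoin i M) ∈ lowDegree n K (d + 1) :=
      mono_mem_lowDegree (by rw [degree_adjoin]; omega)
    simpa using add_mem h1 h2
  induction x using basis_induction X with
  | zero => simp
  | add x y hx hy => simpa using add_mem hx hy
  | smul c x hx => simpa using Submodule.smul_mem _ c hx
  | basis i => exact hbasis i

theorem approxAction_sub_mem (X : Module.Basis (Fin n) K L) (d : ℕ) (i : Fin n)
    (M : Fin n →₀ ℕ) :
    approxAction X d (X i) (mono K M) - mono K (adjoin i M) ∈ lowDegree n K (M.degree + 1) := by
  induction d generalizing i M with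
  | zero => simp [approxAction_zero]
  | succ d ih =>
    rcases le_or_exists_eq_adjoin i M with h | ⟨j, N, rfl, hN, hj⟩
    · simp [approxAction_succ_of_le X d h]
    · rw [approxAction_succ_of_lt X d hN hj, add_sub_cancel_left, degree_adjoin]
      exact add_mem (apply_mem_lowDegree (fun i M _ => ih i M) _ (ih i N))
        (apply_mem_lowDegree (fun i M _ => ih i M) _ (mono_mem_lowDegree (by omega)))

/-- On `x_j N` the recursion calls the previous stage only in degrees up to that of `N`, where the
stages already agree by induction. -/
theorem approxAction_succ_eq (X : Module.Basis (Fin n) K L) (d : ℕ) (x : L)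
    {f : (Fin n →₀ ℕ) →₀ K} (hf : f ∈ lowDegree n K (d + 1)) :
    approxAction X (d + 1) x f = approxAction X d x f := by
  have reduce : ∀ d, (∀ i M, M.degree < d + 1 →
      approxAction X (d + 1) (X i) (mono K M) = approxAction X d (X i) (mono K M)) →
      ∀ x, ∀ f ∈ lowDegree n K (d + 1), approxAction X (d + 1) x f = approxAction X d x f := by
    intro d h x f hf
    have hx : ∀ i, approxAction X (d + 1) (X i) f = approxAction X d (X i) f := fun i =>
      lowDegree_le (P := LinearMap.eqLocus (approxAction X (d + 1) (X i))
        (approxAction X d (X i))) (h i) hf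
    have := X.ext (f₁ := (approxAction X (d + 1)).flip f) (f₂ := (approxAction X d).flip f) hx
    exact LinearMap.congr_fun this x
  refine reduce d ?_ x f hf
  clear hf f x
  induction d with
  | zero =>
    intro i M hM
    rw [approxAction_zero, approxAction_succ_of_le]
    have : M = 0 := by simpa [Finsupp.degree_eq_zero_iff] using hM
    simp [this]
  | succ d ih =>
    intro i M hM
    rcases le_or_exists_eq_adjoin i M with h | ⟨j, N, rfl, hN, hj⟩
    · rw [approxAction_succ_of_le X _ h, approxAction_succ_of_le X _ h]
    · rw [degree_adjoin] at hM
      have hN' : N.degree < d + 1 := by omega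
      rw [approxAction_succ_of_lt X _ hN hj, approxAction_succ_of_lt X _ hN hj, ih i N hN',
        reduce d ih _ _ (mono_mem_lowDegree hN'),
        reduce d ih _ _ (lowDegree_mono (by omega) (approxAction_sub_mem X d i N))]

/-- The action of a Lie algebra on polynomials in the elements of a basis, by left multiplication
on ordered monomials of the universal enveloping algebra. -/
noncomputable def action (X : Module.Basis (Fin n) K L) :
    L →ₗ[K] Module.End K ((Fin n →₀ ℕ) →₀ K) :=
  X.constr K fun i => Finsupp.linearCombination K fun M => approxAction X M.degree (X i) (mono K M)

theorem action_eq (X : Module.Basis (Fin n) K L) {d : ℕ} (x : L)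
    {f : (Fin n →₀ ℕ) →₀ K} (hf : f ∈ lowDegree n K (d + 1)) :
    action X x f = approxAction X d x f := by
  have stable : ∀ d e, d ≤ e → ∀ x, ∀ f ∈ lowDegree n K (d + 1),
      approxAction X e x f = approxAction X d x f := by
    intro d e hde x f hf
    induction e, hde using Nat.le_induction with
    | base => rfl
    | succ e he ih => rw [approxAction_succ_eq X e x (lowDegree_mono (by omega) hf), ih]
  have hx : ∀ i, action X (X i) f = approxAction X d (X i) f := fun i => by
    refine lowDegree_le (P := LinearMap.eqLocus (action X (X i)) (approxAction X d (X i)))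
      (fun M hM => ?_) hf
    rw [LinearMap.mem_eqLocus,
      stable M.degree d (by omega) _ _ (mono_mem_lowDegree (by omega))]
    simp [action]
  exact LinearMap.congr_fun
    (X.ext (f₁ := (action X).flip f) (f₂ := (approxAction X d).flip f) hx) x

theorem action_of_le (X : Module.Basis (Fin n) K L) {i : Fin n} {M : Fin n →₀ ℕ}
    (h : ∀ k ∈ M.support, i ≤ k) : action X (X i) (mono K M) = mono K (adjoin i M) := by
  rw [action_eq X (d := M.degree + 1) _ (mono_mem_lowDegree (by omega)),
    approxAction_succ_of_le X _ h]

theorem action_sub_mem (X : Module.Basis (Fin n) K L) (i : Fin n) (M : Fin n →₀ ℕ) :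
    action X (X i) (mono K M) - mono K (adjoin i M) ∈ lowDegree n K (M.degree + 1) := by
  rw [action_eq X (d := M.degree) _ (mono_mem_lowDegree (by omega))]
  exact approxAction_sub_mem X _ i M

theorem action_mem_lowDegree (X : Module.Basis (Fin n) K L) (x : L) {d : ℕ}
    {f : (Fin n →₀ ℕ) →₀ K} (hf : f ∈ lowDegree n K d) : action X x f ∈ lowDegree n K (d + 1) :=
  apply_mem_lowDegree (fun i M _ => action_sub_mem X i M) x hf

/-- The leading term of the recursion is `X_j (x_i N)`, so it recombines with the remainder into
`X_j (X_i N)`. -/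
theorem action_adjoin_of_lt (X : Module.Basis (Fin n) K L) {i j : Fin n} {N : Fin n →₀ ℕ}
    (hN : ∀ k ∈ N.support, j ≤ k) (hj : j < i) :
    action X (X i) (mono K (adjoin j N)) =
      action X (X j) (action X (X i) (mono K N)) + action X ⁅X i, X j⁆ (mono K N) := by
  have hle : ∀ k ∈ (adjoin i N).support, j ≤ k := fun k hk => by
    rcases Finset.mem_union.1 (Finsupp.support_add hk) with h | h
    · rw [Finset.mem_singleton.1 (Finsupp.support_single_subset h)]
      exact hj.le
    · exact hN k h
  have hmem := mono_mem_lowDegree (K := K) (Nat.lt_succ_self N.degree)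
  rw [action_eq X (d := N.degree + 1) _
      (mono_mem_lowDegree (by rw [degree_adjoin]; omega)), approxAction_succ_of_lt X _ hN hj,
    ← action_eq X _ hmem, ← action_eq X _ hmem, ← action_eq X _ (action_sub_mem X i N), map_sub,
    action_of_le X hle, adjoin_left_comm j i]
  abel

/-- On the polynomial `f`, the commutator of the actions of `x` and `y` is the action of their
bracket. -/
def Compatible (X : Module.Basis (Fin n) K L) (x y : L) (f : (Fin n →₀ ℕ) →₀ K) : Prop :=
  action X x (action X y f) = action X y (action X x f) + action X ⁅x, y⁆ f

theorem Compatible.symm {X : Module.Basis (Fin n) K L} {x y : L} {f : (Fin n →₀ ℕ) →₀ K}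
    (h : Compatible X x y f) : Compatible X y x f := by
  unfold Compatible at *
  rw [h, ← lie_skew x y, map_neg, LinearMap.neg_apply]
  abel

theorem Compatible.add {X : Module.Basis (Fin n) K L} {x y : L} {f g : (Fin n →₀ ℕ) →₀ K}
    (hf : Compatible X x y f) (hg : Compatible X x y g) : Compatible X x y (f + g) := by
  unfold Compatible at *
  simp only [map_add, hf, hg]
  abel

theorem compatible_of_mono {X : Module.Basis (Fin n) K L} {d : ℕ}
    (h : ∀ i j M, M.degree < d → Compatible X (X i) (X j) (mono K M)) (x y : L)
    {f : (Fin n →₀ ℕ) →₀ K} (hf : f ∈ lowDegree n K d) : Compatible X x y f := by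
  have basis : ∀ i j, Compatible X (X i) (X j) f := fun i j =>
    lowDegree_le (P := LinearMap.eqLocus (action X (X i) * action X (X j))
      (action X (X j) * action X (X i) + action X ⁅X i, X j⁆)) (h i j) hf
  unfold Compatible at *
  induction x using basis_induction X with
  | zero => simp
  | add x x' hx hx' => simp only [map_add, LinearMap.add_apply, add_lie, hx, hx']; abel
  | smul c x hx => simp only [map_smul, LinearMap.smul_apply, smul_lie, hx, smul_add]
  | basis i =>
    induction y using basis_induction X with
    | zero => simp
    | add x x' hx hx' => simp only [map_add, LinearMap.add_apply, lie_add, hx, hx']; abel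
    | smul c x hx => simp only [map_smul, LinearMap.smul_apply, lie_smul, hx, smul_add]
    | basis j => exact basis i j

theorem compatible_of_le (X : Module.Basis (Fin n) K L) {i j : Fin n} {N : Fin n →₀ ℕ}
    (hN : ∀ k ∈ N.support, j ≤ k) (hj : j ≤ i) : Compatible X (X i) (X j) (mono K N) := by
  rcases hj.lt_or_eq with hj | rfl
  · rw [Compatible, action_of_le X hN, action_adjoin_of_lt X hN hj]
  · simp [Compatible]

/-- By skew symmetry `j ≤ i`. The case left by `compatible_of_le` is `M = X_k N` with `k < j`: there
`X_k` is moved to the left of `X_i` and `X_j`, induction handles the brackets acting on `N`, and the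
double brackets cancel by Jacobi. -/
theorem compatible_basis (X : Module.Basis (Fin n) K L) (d : ℕ) :
    ∀ i j M, M.degree < d → Compatible X (X i) (X j) (mono K M) := by
  induction d with
  | zero => intro i j M h; omega
  | succ d ih =>
    intro i j M hM
    wlog hij : j ≤ i generalizing i j
    · exact (this j i (le_of_not_ge hij)).symm
    rcases le_or_exists_eq_adjoin j M with h | ⟨k, N, rfl, hN, hk⟩
    · exact compatible_of_le X h hij
    rw [degree_adjoin] at hM
    have ih' := fun x y f => compatible_of_mono (f := f) ih x y
    have hmem : mono K N ∈ lowDegree n K d := mono_mem_lowDegree (by omega)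
    -- `k` commutes past every letter larger than it, up to brackets
    have step : ∀ a b, k < a → k < b → Compatible X (X a) (X k) (action X (X b) (mono K N)) := by
      intro a b ha hb
      have hle : ∀ l ∈ (adjoin b N).support, k ≤ l := fun l hl => by
        rcases Finset.mem_union.1 (Finsupp.support_add hl) with h | h
        · rw [Finset.mem_singleton.1 (Finsupp.support_single_subset h)]
          exact hb.le
        · exact hN l h
      -- The lower-degree part of `X_b N` falls under the induction hypothesis; in its leading term
      -- `x_b N` no letter is less than `k`.
      have := (ih' (X a) (X k) _ (lowDegree_mono (by omega) (action_sub_mem X b N))).add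
        (compatible_of_le X hle ha.le)
      simpa using this
    have hi : k < i := hk.trans_le hij
    have s1 := step i j hi hk
    have s2 := step j i hk hi
    have c1 := ih' (X i) ⁅X j, X k⁆ _ hmem
    have c2 := ih' (X j) ⁅X i, X k⁆ _ hmem
    have c3 := ih' (X i) (X j) _ hmem
    have c4 := ih' ⁅X i, X j⁆ (X k) _ hmem
    have e := action_of_le X hN
    have k1 := compatible_of_le X hN hi.le
    have k2 := compatible_of_le X hN hk.le
    have jac : action X ⁅X i, ⁅X j, X k⁆⁆ (mono K N) =
        action X ⁅⁅X i, X j⁆, X k⁆ (mono K N) + action X ⁅X j, ⁅X i, X k⁆⁆ (mono K N) := by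
      rw [leibniz_lie, map_add, LinearMap.add_apply]
    unfold Compatible at *
    rw [← e, k1, k2, map_add, map_add, s1, s2, c1, c2, c3, c4, jac, map_add]
    abel

theorem compatible (X : Module.Basis (Fin n) K L) (x y : L) (f : (Fin n →₀ ℕ) →₀ K) :
    Compatible X x y f := by
  obtain ⟨d, hd⟩ := exists_mem_lowDegree f
  exact compatible_of_mono (compatible_basis X d) x y hd

attribute [local instance 100] LieRing.ofAssociativeRing

/-- The representation of the universal enveloping algebra that extends `action`. -/
noncomputable def envelopingAction (X : Module.Basis (Fin n) K L) :
    UniversalEnvelopingAlgebra K L →ₐ[K] Module.End K ((Fin n →₀ ℕ) →₀ K) :=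
  UniversalEnvelopingAlgebra.lift K
    { action X with
      map_lie' := by
        intro x y
        refine LinearMap.ext fun f => ?_
        have := compatible X x y f
        unfold Compatible at this
        simp [LieRing.of_associative_ring_bracket, this] }

theorem envelopingAction_ι (X : Module.Basis (Fin n) K L) (x : L) :
    envelopingAction X (UniversalEnvelopingAlgebra.ι K x) = action X x :=
  UniversalEnvelopingAlgebra.lift_ι_apply K _ x

end Action

end PBW

namespace PBW

/-! ### Words and their exponents -/

section Words

variable {n : ℕ}

/-- The exponent of the commutative monomial that underlies a word. -/
noncomputable def content (w : Word n) : Fin n →₀ ℕ := (w.map fun i => Finsupp.single i 1).sum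

theorem content_cons (i : Fin n) (w : Word n) : content (i :: w) = adjoin i (content w) := by
  simp [content]

theorem content_apply (w : Word n) (i : Fin n) : content w i = w.count i := by
  induction w with
  | nil => simp [content]
  | cons j w ih =>
    rw [content_cons, List.count_cons, ← ih]
    simp [adjoin, Finsupp.single_apply, add_comm]

theorem perm_iff_content_eq {v w : Word n} : v.Perm w ↔ content v = content w := by
  rw [List.perm_iff_count, DFunLike.ext_iff]
  simp [content_apply]

theorem content_sortedWord (α : Fin n →₀ ℕ) : content (sortedWord α) = α := by
  ext i
  rw [content_apply, sortedWord, List.count_flatMap]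
  simp only [Function.comp_def, List.count_replicate]
  rw [← List.ofFn_eq_map, List.sum_ofFn]
  simp

theorem sortedWord_pairwise (α : Fin n →₀ ℕ) : (sortedWord α).Pairwise (· ≤ ·) := by
  rw [sortedWord, List.pairwise_flatMap]
  refine ⟨fun i _ => by simp [List.pairwise_replicate], ?_⟩
  refine (List.pairwise_lt_finRange n).imp fun {i j} hij x hx y hy => ?_
  rw [List.eq_of_mem_replicate hx, List.eq_of_mem_replicate hy]
  exact hij.le

/-- Sorted words with the same content coincide. -/
theorem sortedWord_adjoin {i : Fin n} {α : Fin n →₀ ℕ} (h : ∀ k ∈ α.support, i ≤ k) :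
    sortedWord (adjoin i α) = i :: sortedWord α := by
  refine List.Perm.eq_of_pairwise' (r := (· ≤ ·)) (sortedWord_pairwise _)
    (List.pairwise_cons.2 ⟨fun k hk => h k ?_, sortedWord_pairwise α⟩) ?_
  · rw [Finsupp.mem_support_iff, ← content_sortedWord α, content_apply]
    exact (List.count_pos_iff.2 hk).ne'
  · rw [perm_iff_content_eq, content_cons, content_sortedWord, content_sortedWord]

end Words

/-! ### Leading terms and bases of the enveloping algebra -/

section Basis

variable {n : ℕ} {K : Type*} [Field K] {L : Type*} [LieRing L] [LieAlgebra K L]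

theorem toEnveloping_ι (X : Module.Basis (Fin n) K L) (i : Fin n) :
    toEnveloping X (FreeAlgebra.ι K i) = UniversalEnvelopingAlgebra.ι K (X i) := by
  simp [toEnveloping, FreeAlgebra.lift_ι_apply]

theorem toEnveloping_monomial (X : Module.Basis (Fin n) K L) (w : Word n) :
    toEnveloping X (monomial K w) =
      (w.map fun i => UniversalEnvelopingAlgebra.ι K (X i)).prod := by
  rw [monomial, map_list_prod, List.map_map]
  simp [Function.comp_def, toEnveloping_ι]

theorem toEnveloping_monomial_cons (X : Module.Basis (Fin n) K L) (i : Fin n) (w : Word n) :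
    toEnveloping X (monomial K (i :: w)) =
      UniversalEnvelopingAlgebra.ι K (X i) * toEnveloping X (monomial K w) := by
  simp [toEnveloping_monomial]

/-- The linear map from polynomials to the enveloping algebra that sends each monomial to the
corresponding ordered monomial. -/
noncomputable def orderedMap (X : Module.Basis (Fin n) K L) :
    ((Fin n →₀ ℕ) →₀ K) →ₗ[K] UniversalEnvelopingAlgebra K L :=
  Finsupp.linearCombination K fun α => toEnveloping X (monomial K (sortedWord α))

theorem orderedMap_mono (X : Module.Basis (Fin n) K L) (α : Fin n →₀ ℕ) :
    orderedMap X (mono K α) = toEnveloping X (monomial K (sortedWord α)) := by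
  simp [orderedMap]

theorem orderedMap_adjoin (X : Module.Basis (Fin n) K L) {i : Fin n} {M : Fin n →₀ ℕ}
    (h : ∀ k ∈ M.support, i ≤ k) : orderedMap X (mono K (adjoin i M)) =
      UniversalEnvelopingAlgebra.ι K (X i) * orderedMap X (mono K M) := by
  rw [orderedMap_mono, orderedMap_mono, sortedWord_adjoin h, toEnveloping_monomial_cons]

attribute [local instance 100] LieRing.ofAssociativeRing

theorem ι_mul_ι (x y : L) :
    UniversalEnvelopingAlgebra.ι K x * UniversalEnvelopingAlgebra.ι K y =
      UniversalEnvelopingAlgebra.ι K y * UniversalEnvelopingAlgebra.ι K x +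
        UniversalEnvelopingAlgebra.ι K ⁅x, y⁆ := by
  rw [LieHom.map_lie, LieRing.of_associative_ring_bracket]
  abel

/-- The recursion for `action` mirrors the relation `ι_mul_ι` of the enveloping algebra, so
induction on the degree applies. -/
theorem orderedMap_action (X : Module.Basis (Fin n) K L) (x : L) (f : (Fin n →₀ ℕ) →₀ K) :
    orderedMap X (action X x f) = UniversalEnvelopingAlgebra.ι K x * orderedMap X f := by
  have reduce : ∀ d, (∀ i M, M.degree < d → orderedMap X (action X (X i) (mono K M)) =
        UniversalEnvelopingAlgebra.ι K (X i) * orderedMap X (mono K M)) →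
      ∀ x, ∀ f ∈ lowDegree n K d,
        orderedMap X (action X x f) = UniversalEnvelopingAlgebra.ι K x * orderedMap X f := by
    intro d h x f hf
    induction x using basis_induction X with
    | zero => simp
    | add x y hx hy => simp only [map_add, LinearMap.add_apply, hx, hy, add_mul]
    | smul c x hx => simp only [map_smul, LinearMap.smul_apply, hx, smul_mul_assoc]
    | basis i =>
      exact lowDegree_le (P := LinearMap.eqLocus (orderedMap X ∘ₗ action X (X i))
        (LinearMap.mulLeft K (UniversalEnvelopingAlgebra.ι K (X i)) ∘ₗ orderedMap X)) (h i) hf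
  have main : ∀ d i M, M.degree < d → orderedMap X (action X (X i) (mono K M)) =
      UniversalEnvelopingAlgebra.ι K (X i) * orderedMap X (mono K M) := by
    intro d
    induction d with
    | zero => intro i M h; omega
    | succ d ih =>
      intro i M hM
      rcases le_or_exists_eq_adjoin i M with h | ⟨j, N, rfl, hN, hj⟩
      · rw [action_of_le X h, orderedMap_adjoin X h]
      rw [degree_adjoin] at hM
      have hN' : N.degree < d := by omega
      have hle : ∀ k ∈ (adjoin i N).support, j ≤ k := fun k hk => by
        rcases Finset.mem_union.1 (Finsupp.support_add hk) with h | h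
        · rw [Finset.mem_singleton.1 (Finsupp.support_single_subset h)]
          exact hj.le
        · exact hN k h
      -- `X_i N` may have degree `d`, out of reach of the induction hypothesis; its leading term
      -- `x_i N` is treated by `orderedMap_adjoin`.
      have key : orderedMap X (action X (X j) (action X (X i) (mono K N))) =
          UniversalEnvelopingAlgebra.ι K (X j) * orderedMap X (action X (X i) (mono K N)) := by
        have h1 := reduce d ih (X j) _ (lowDegree_mono (by omega) (action_sub_mem X i N))
        have h2 := orderedMap_adjoin X (K := K) hle
        rw [← action_of_le X hle] at h2
        simpa [mul_sub, h2] using h1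
      rw [action_adjoin_of_lt X hN hj, map_add, key, ih i N hN',
        reduce d ih _ _ (mono_mem_lowDegree hN'), orderedMap_adjoin X hN, ← mul_assoc,
        ← mul_assoc, ← add_mul, ι_mul_ι (X i) (X j)]
  obtain ⟨d, hd⟩ := exists_mem_lowDegree f
  exact reduce d (main d) x f hd

theorem orderedMap_envelopingAction (X : Module.Basis (Fin n) K L)
    (u : UniversalEnvelopingAlgebra K L) (f : (Fin n →₀ ℕ) →₀ K) :
    orderedMap X (envelopingAction X u f) = u * orderedMap X f := by
  have hgen : ∀ t : TensorAlgebra K L, ∀ f : (Fin n →₀ ℕ) →₀ K,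
      orderedMap X (envelopingAction X (UniversalEnvelopingAlgebra.mkAlgHom K L t) f) =
        UniversalEnvelopingAlgebra.mkAlgHom K L t * orderedMap X f := by
    intro t
    induction t using TensorAlgebra.induction with
    | algebraMap r =>
      intro f
      simp [Algebra.algebraMap_eq_smul_one]
    | ι x =>
      intro f
      have h : UniversalEnvelopingAlgebra.mkAlgHom K L (TensorAlgebra.ι K x) =
        UniversalEnvelopingAlgebra.ι K x := rfl
      rw [h, envelopingAction_ι, orderedMap_action]
    | mul a b ha hb => intro f; simp [ha, hb, mul_assoc]
    | add a b ha hb => intro f; simp [ha, hb, add_mul]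
  obtain ⟨t, rfl⟩ : ∃ t, UniversalEnvelopingAlgebra.mkAlgHom K L t = u := by
    exact Quotient.exists_rep u
  exact hgen t f

/-- The polynomial of an element of the enveloping algebra: the result of its action on `1`. -/
noncomputable def symbolMap (X : Module.Basis (Fin n) K L) :
    UniversalEnvelopingAlgebra K L →ₗ[K] ((Fin n →₀ ℕ) →₀ K) :=
  (LinearMap.applyₗ (mono K 0)) ∘ₗ (envelopingAction X).toLinearMap

theorem symbolMap_apply (X : Module.Basis (Fin n) K L) (u : UniversalEnvelopingAlgebra K L) :
    symbolMap X u = envelopingAction X u (mono K 0) := rfl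

/-- Intertwining, applied to the polynomial `1`. This replaces a straightening argument for
spanning. -/
theorem orderedMap_symbolMap (X : Module.Basis (Fin n) K L) (u : UniversalEnvelopingAlgebra K L) :
    orderedMap X (symbolMap X u) = u := by
  have h : sortedWord (0 : Fin n →₀ ℕ) = [] := by
    simp [sortedWord]
  rw [symbolMap_apply, orderedMap_envelopingAction, orderedMap_mono, h]
  simp [monomial]

theorem symbolMap_monomial_sub_mem (X : Module.Basis (Fin n) K L) (w : Word n) :
    symbolMap X (toEnveloping X (monomial K w)) - mono K (content w) ∈
      lowDegree n K (content w).degree := by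
  induction w with
  | nil => simp [symbolMap_apply, monomial, content]
  | cons i w ih =>
    have h1 := action_mem_lowDegree X (X i) ih
    have h2 := add_mem h1 (action_sub_mem X i (content w))
    rw [map_sub, sub_add_sub_cancel] at h2
    rw [symbolMap_apply, toEnveloping_monomial_cons, map_mul, envelopingAction_ι, content_cons,
      degree_adjoin]
    exact h2

/-- The Poincaré–Birkhoff–Witt theorem, for a family in the enveloping algebra whose members have
the monomials as leading terms. -/
theorem exists_basis_of_symbol (X : Module.Basis (Fin n) K L)
    (b : (Fin n →₀ ℕ) → UniversalEnvelopingAlgebra K L)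
    (hb : ∀ α, symbolMap X (b α) - mono K α ∈ lowDegree n K α.degree) :
    ∃ B : Module.Basis (Fin n →₀ ℕ) K (UniversalEnvelopingAlgebra K L), ∀ α, B α = b α := by
  have bij : ∀ c : (Fin n →₀ ℕ) → UniversalEnvelopingAlgebra K L,
      (∀ α, symbolMap X (c α) - mono K α ∈ lowDegree n K α.degree) →
      Function.Bijective (symbolMap X ∘ₗ Finsupp.linearCombination K c) := fun c hc =>
    bijective_of_unitriangular _ fun M => by simpa using hc M
  have hsym : Function.Bijective (symbolMap X) := by
    refine ⟨Function.LeftInverse.injective (orderedMap_symbolMap X), ?_⟩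
    exact Function.Surjective.of_comp (bij b hb).surjective
  -- Cancelling the bijection `symbolMap` gives independence and spanning at once.
  have hlin : Function.Bijective (Finsupp.linearCombination K b) :=
    (Function.Bijective.of_comp_iff' hsym _).1 (bij b hb)
  exact ⟨⟨(LinearEquiv.ofBijective _ hlin).symm⟩, fun α => by simp [Module.Basis.coe_ofRepr]⟩

/-- All rearrangements of `w` share one leading monomial, so their average has it too;
characteristic zero makes `m!` invertible. -/
theorem symbolMap_sym_sub_mem [CharZero K] (X : Module.Basis (Fin n) K L) (w : Word n) :
    symbolMap X (toEnveloping X (sym K w)) - mono K (content w) ∈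
      lowDegree n K (content w).degree := by
  have hσ : ∀ σ : Equiv.Perm (Fin w.length),
      content (List.ofFn fun j => w.get (σ j)) = content w := fun σ => by
    rw [← perm_iff_content_eq]
    simpa [Function.comp_def] using σ.ofFn_comp_perm w.get
  have hne : ((w.length ! : ℕ) : K) ≠ 0 := Nat.cast_ne_zero.2 (Nat.factorial_ne_zero _)
  have hsum : mono K (content w) = ((w.length ! : ℕ) : K)⁻¹ •
      ∑ _σ : Equiv.Perm (Fin w.length), mono K (content w) := by
    rw [Finset.sum_const, Finset.card_univ, Fintype.card_perm, Fintype.card_fin,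
      ← Nat.cast_smul_eq_nsmul K, smul_smul, inv_mul_cancel₀ hne, one_smul]
  rw [hsum, sym, map_smul, map_smul, map_sum, map_sum, ← smul_sub, ← Finset.sum_sub_distrib]
  refine Submodule.smul_mem _ _ (Submodule.sum_mem _ fun σ _ => ?_)
  have := symbolMap_monomial_sub_mem X (List.ofFn fun j => w.get (σ j))
  rwa [hσ] at this

end Basis

end PBW

/-! ### The four statements -/

theorem corollary3p12 {K L : Type*} [Field K] [CharZero K] [LieRing L] [LieAlgebra K L]
    (n : ℕ) (X : Module.Basis (Fin n) K L) :
    -- the symmetrized monomials form a basis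
    (∃ B : Module.Basis (Fin n →₀ ℕ) K (UniversalEnvelopingAlgebra K L),
      ∀ α, B α = PBW.toEnveloping X (PBW.sym K (PBW.sortedWord α))) ∧
    -- any choice of one monomial per equipollence class is a basis
    (∀ S : Set (PBW.Word n), PBW.IsRepresentativeSystem S →
      ∃ B : Module.Basis S K (UniversalEnvelopingAlgebra K L),
        ∀ w : S, B w = PBW.toEnveloping X (PBW.monomial K (w : PBW.Word n))) ∧
    -- the ordered monomials form a basis
    (∃ B : Module.Basis (Fin n →₀ ℕ) K (UniversalEnvelopingAlgebra K L),
      ∀ α, B α = (List.ofFn fun i => UniversalEnvelopingAlgebra.ι K (X i) ^ α i).prod) ∧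
    -- symmetrization is a linear isomorphism from commutative polynomials
    (∃ e : MvPolynomial (Fin n) K ≃ₗ[K] UniversalEnvelopingAlgebra K L,
      ∀ p, e p = PBW.toEnveloping X (PBW.symmetrization K n p)) := by
  obtain ⟨B, hB⟩ := PBW.exists_basis_of_symbol X
    (fun α => PBW.toEnveloping X (PBW.sym K (PBW.sortedWord α))) fun α => by
      simpa only [PBW.content_sortedWord] using
        PBW.symbolMap_sym_sub_mem X (PBW.sortedWord α)
  refine ⟨⟨B, hB⟩, fun S hS => ?_, ?_, ?_⟩
  -- Equipollence classes correspond to exponents, so `S` can be reindexed by exponents.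
  · have hbij : Function.Bijective fun w : S => PBW.content (w : PBW.Word n) := by
      refine ⟨fun v w hvw => Subtype.ext ?_, fun α => ?_⟩
      · exact (hS w).unique ⟨v.2, PBW.perm_iff_content_eq.2 hvw⟩ ⟨w.2, List.Perm.refl _⟩
      · obtain ⟨w, ⟨hw, hp⟩, -⟩ := hS (PBW.sortedWord α)
        exact ⟨⟨w, hw⟩, (PBW.perm_iff_content_eq.1 hp).trans (PBW.content_sortedWord α)⟩
    let e := Equiv.ofBijective _ hbij
    obtain ⟨C, hC⟩ := PBW.exists_basis_of_symbol X
      (fun α => PBW.toEnveloping X (PBW.monomial K (e.symm α : PBW.Word n))) fun α => by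
        have hα : PBW.content (e.symm α : PBW.Word n) = α := e.apply_symm_apply α
        simpa only [hα] using PBW.symbolMap_monomial_sub_mem X (e.symm α : PBW.Word n)
    exact ⟨C.reindex e.symm, fun w => by simp [hC]⟩
  · obtain ⟨C, hC⟩ := PBW.exists_basis_of_symbol X
      (fun α => PBW.toEnveloping X (PBW.monomial K (PBW.sortedWord α))) fun α => by
        simpa only [PBW.content_sortedWord] using
          PBW.symbolMap_monomial_sub_mem X (PBW.sortedWord α)
    refine ⟨C, fun α => ?_⟩
    rw [hC, PBW.toEnveloping_monomial, PBW.sortedWord, List.flatMap_def, List.map_flatten, List.prod_flatten]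
    simp [List.ofFn_eq_map, Function.comp_def]
  · refine ⟨(MvPolynomial.basisMonomials (Fin n) K).equiv B (Equiv.refl _), fun p => ?_⟩
    have h : ((MvPolynomial.basisMonomials (Fin n) K).equiv B (Equiv.refl _)).toLinearMap =
        (PBW.toEnveloping X).toLinearMap ∘ₗ PBW.symmetrization K n := by
      refine (MvPolynomial.basisMonomials (Fin n) K).ext fun α => ?_
      rw [LinearEquiv.coe_coe, Module.Basis.equiv_apply, Equiv.refl_apply, hB,
        LinearMap.comp_apply, PBW.symmetrization, Module.Basis.constr_basis]
      rfl
    exact LinearMap.congr_fun h p
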